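/- A two counter machine (TCM) is a finite program operating on two counters holding natural numbers, with instructions $x\leftarrow x+1$, $x\leftarrow x-1$ (an empty counter stays empty), "if $x=0$ then goto $l$", "goto $l$" and "halt", where $x$ is either of the two counters. A TCM computes a total function $f:\mathbb N\to\mathbb N$ if, for a fixed choice of an input counter and an output counter, for every $n$, when started with $n$ in the input counter and the other counter empty, it halts with $f(n)$ in the output counter. For a radix $b\ge 2$, a two counter machine with input (TCMI) in radix $b$ is a finite program that may in addition use input instructions, each of which waits for the next symbol of the input alphabet $\{0,1,\dots,b-1,\diamond\}$, consumes it, and branches according to it; a line with an input instruction is called a wait state. A TCMI starts in its initial state with both counters empty. For a finite string $I$ of $b$-digits let $\ulcorner I\urcorner$ be its value in radix $b$, the first digit being the least significant one (leading zeros allowed, the empty string having value $0$). A TCMI counts in radix $b$ if for every finite string $I$ of $b$-digits, being input $I$ followed by the stop marker $\diamond$, it consumes the whole input and halts with $\ulcorner I\urcorner$ in its first counter and its second counter empty. Theorem. Let $f:\mathbb N\to\mathbb N$ be a total function with unbounded range that is computed by some TCM, and let $b\ge 2$. Suppose there is a TCMI $M$ in radix $b$ such that for every finite string $I$ of $b$-digits,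 being input $I\diamond$ (least significant digit first), $M$ consumes the whole input and then stops, in a wait state or a halting state, with $f(\ulcorner I\urcorner)$ in its first counter and its second counter empty. Then there is a TCMI $M'$ that counts in radix $b$. -/

import Mathlib

/-- The instructions of a two counter machine that do not look at an input.  `Q` is the set of
states (program lines), the counters are indexed by `Fin 2`, and every instruction names the
line(s) at which the program continues.  Decrementing an empty counter leaves it empty. -/
inductive CounterInstr (Q : Type) : Type where
  | inc (i : Fin 2) (next : Q)
  | dec (i : Fin 2) (next : Q)
  | ifZero (i : Fin 2) (yes no : Q)
  | goto (next : Q)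
  | halt

/-- The effect of an instruction on the pair of counters `c`: the next line and the new
counters, or `none` for `halt`. -/
def CounterInstr.exec {Q : Type} (c : Fin 2 → ℕ) : CounterInstr Q → Option (Q × (Fin 2 → ℕ))
  | .inc i q => some (q, Function.update c i (c i + 1))
  | .dec i q => some (q, Function.update c i (c i - 1))
  | .ifZero i yes no => some (if c i = 0 then yes else no, c)
  | .goto q => some (q, c)
  | .halt => none

/-- A two counter (Minsky) machine: a finite program over two counters. -/
structure TCM where
  State : Type
  finite_state : Finite State
  start : State
  prog : State → CounterInstr State

namespace TCM

/-- One step of a computation; a configuration is a state with the values of both counters. -/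
def step (M : TCM) (x : M.State × (Fin 2 → ℕ)) : Option (M.State × (Fin 2 → ℕ)) :=
  (M.prog x.1).exec x.2

/-- `M` computes the total function `f`: for a fixed input counter `i` and a fixed output counter
`j`, when `M` is started with `n` in counter `i` and the other counter empty, it halts with `f n`
in counter `j`. -/
def Computes (M : TCM) (f : ℕ → ℕ) : Prop :=
  ∃ i j : Fin 2, ∀ n : ℕ, ∃ (q : M.State) (c : Fin 2 → ℕ),
    Relation.ReflTransGen (fun x y => M.step x = some y) (M.start, Pi.single i n) (q, c) ∧
      M.prog q = .halt ∧ c j = f n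

end TCM

/-- The input alphabet in radix `b`: the digits `0, …, b - 1` and the stop marker. -/
inductive InputSymbol (b : ℕ) : Type where
  | digit (d : Fin b)
  | endMark

/-- The instructions of a two counter machine with input: those of a two counter machine, and
`read`, which waits for the next input symbol, consumes it, and branches on it. -/
inductive InputInstr (b : ℕ) (Q : Type) : Type where
  | op (instr : CounterInstr Q)
  | read (next : InputSymbol b → Q)

/-- A two counter machine with input in radix `b`. -/
structure TCMI (b : ℕ) where
  State : Type
  finite_state : Finite State
  start : State
  prog : State → InputInstr b State

namespace TCMI

/-- A configuration: the state, the counters, and the part of the input not yet consumed. -/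
structure Cfg {b : ℕ} (M : TCMI b) where
  state : M.State
  counters : Fin 2 → ℕ
  input : List (InputSymbol b)

/-- One step of a computation; `none` if `M` has halted, or waits for input and there is none
left. -/
def step {b : ℕ} (M : TCMI b) (x : M.Cfg) : Option M.Cfg :=
  match M.prog x.state with
  | .op instr => (instr.exec x.counters).map fun y => ⟨y.1, y.2, x.input⟩
  | .read next =>
    match x.input with
    | [] => none
    | s :: rest => some ⟨next s, x.counters, rest⟩

/-- `M`, started in its initial state with empty counters, consumes the whole input `z` and
arrives at the state `w` with `n₁` and `n₂` in its counters. -/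
def Reaches {b : ℕ} (M : TCMI b) (z : List (InputSymbol b)) (w : M.State) (n₁ n₂ : ℕ) : Prop :=
  Relation.ReflTransGen (fun x y => M.step x = some y) ⟨M.start, ![0, 0], z⟩ ⟨w, ![n₁, n₂], []⟩

/-- `w` is a wait state: its instruction asks for input. -/
def IsWait {b : ℕ} (M : TCMI b) (w : M.State) : Prop := ∃ next, M.prog w = .read next

/-- `w` is a halting state. -/
def IsHalt {b : ℕ} (M : TCMI b) (w : M.State) : Prop := M.prog w = .op .halt

end TCMI

/-- The string of digits `I` followed by the stop marker. -/
def withStop {b : ℕ} (I : List (Fin b)) : List (InputSymbol b) :=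
  I.map InputSymbol.digit ++ [InputSymbol.endMark]

/-- The value in radix `b` of a string of digits, the least significant digit being the first. -/
def digitValue {b : ℕ} (I : List (Fin b)) : ℕ := Nat.ofDigits b (I.map Fin.val)

/-- `M` counts in radix `b`: on every string of `b`-digits (leading zeros allowed), presented
starting with the least significant digit and followed by the stop marker, `M` halts with the
value of the string in its first counter and its second counter empty. -/
def TCMI.Counts {b : ℕ} (M : TCMI b) : Prop :=
  ∀ I : List (Fin b), ∃ w, M.IsHalt w ∧ M.Reaches (withStop I) w (digitValue I) 0

/-! A two counter machine with unbounded output is forced to be affine somewhere: there are `n`, `A`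
and `Q > 0` with `f (n + k * A) = f n + k * Q` for all `k`. Given this, the counting machine feeds
`M` the digits of `A * k + n` while reading those of `k`. A bounded carry suffices for that, so
finitely many states do. It then subtracts `f n` and divides by `Q`, using the counter that `M`
leaves empty.

For the affine family, cut a halting run with very large output at the times when a counter is
empty. Between two such times a step depends on the state only, so once a state repeats the run is a
loop with constant drift. If such a phase empties one counter and leaves the other large, its loop
lowers the first and raises the second. Extra turns of the loop then transfer a suitable surplus
from one counter to the other. Composing these transfers along the run gives the family
(`exists_linear_family`). The output must exceed every output obtainable from small counters, so no
intermediate cut has both counters small; this is where unbounded range is used. -/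

/-! ### Runs of a two counter machine: determinism, shifts and loops -/

namespace TCM

/-- One step of a computation, made total: a halted configuration stays as it is. -/
def next (M : TCM) (x : M.State × (Fin 2 → ℕ)) : M.State × (Fin 2 → ℕ) :=
  (M.step x).getD x

/-- Started at `x`, the machine halts with `o` in counter `j`. -/
def HaltsWith (M : TCM) (j : Fin 2) (x : M.State × (Fin 2 → ℕ)) (o : ℕ) : Prop :=
  ∃ t, M.prog (M.next^[t] x).1 = .halt ∧ (M.next^[t] x).2 j = o

variable {M : TCM}

theorem next_of_halt {x : M.State × (Fin 2 → ℕ)} (h : M.prog x.1 = .halt) : M.next x = x := by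
  simp [next, step, h, CounterInstr.exec]

theorem iterate_next_of_halt {x : M.State × (Fin 2 → ℕ)} (h : M.prog x.1 = .halt) (t : ℕ) :
    M.next^[t] x = x :=
  Function.iterate_fixed (next_of_halt h) t

theorem HaltsWith.unique {j : Fin 2} {x : M.State × (Fin 2 → ℕ)} {o o' : ℕ}
    (h : M.HaltsWith j x o) (h' : M.HaltsWith j x o') : o = o' := by
  obtain ⟨t, ht, rfl⟩ := h
  obtain ⟨t', ht', rfl⟩ := h'
  rcases le_total t t' with hle | hle
  · obtain ⟨d, rfl⟩ := Nat.exists_eq_add_of_le' hle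
    rw [Function.iterate_add_apply, iterate_next_of_halt ht]
  · obtain ⟨d, rfl⟩ := Nat.exists_eq_add_of_le' hle
    rw [Function.iterate_add_apply, iterate_next_of_halt ht']

theorem HaltsWith.of_iterate {j : Fin 2} {x : M.State × (Fin 2 → ℕ)} {o : ℕ} (s : ℕ)
    (h : M.HaltsWith j (M.next^[s] x) o) : M.HaltsWith j x o := by
  obtain ⟨t, ht, hto⟩ := h
  rw [← Function.iterate_add_apply] at ht hto
  exact ⟨t + s, ht, hto⟩

theorem exists_iterate_of_reflTransGen {x y : M.State × (Fin 2 → ℕ)}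
    (h : Relation.ReflTransGen (fun x y => M.step x = some y) x y) : ∃ t, M.next^[t] x = y := by
  induction h with
  | refl => exact ⟨0, rfl⟩
  | @tail y z _ hyz ih =>
    obtain ⟨t, rfl⟩ := ih
    refine ⟨t + 1, ?_⟩
    rw [Function.iterate_succ_apply', next, hyz, Option.getD_some]

/-- A step commutes with increasing the nonzero counters. -/
theorem next_add (q : M.State) (c v : Fin 2 → ℕ) (h : ∀ k, c k = 0 → v k = 0) :
    M.next (q, c + v) = ((M.next (q, c)).1, (M.next (q, c)).2 + v) := by
  unfold next step
  cases hq : M.prog q with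
  | inc i p =>
    simp only [CounterInstr.exec, Option.getD_some, Prod.mk.injEq, true_and]
    ext k
    by_cases hk : k = i
    · subst hk; simp; omega
    · simp [hk]
  | dec i p =>
    simp only [CounterInstr.exec, Option.getD_some, Prod.mk.injEq, true_and]
    ext k
    by_cases hk : k = i
    · subst hk; have := h k; simp; omega
    · simp [hk]
  | ifZero i p r =>
    have := h i
    by_cases hi : c i = 0 <;> simp_all [CounterInstr.exec]
  | goto p => simp [CounterInstr.exec]
  | halt => simp [CounterInstr.exec]

/-- Only times `s < t` matter: the last configuration is not acted upon, so a shifted counter may be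
empty there. -/
theorem iterate_next_add (x : M.State × (Fin 2 → ℕ)) (v : Fin 2 → ℕ) (t : ℕ)
    (h : ∀ s < t, ∀ k, (M.next^[s] x).2 k = 0 → v k = 0) :
    M.next^[t] (x.1, x.2 + v) = ((M.next^[t] x).1, (M.next^[t] x).2 + v) := by
  induction t with
  | zero => rfl
  | succ t ih =>
    rw [Function.iterate_succ_apply', ih fun s hs => h s (by omega),
      next_add _ _ _ (h t (by omega)), Function.iterate_succ_apply']

theorem next_le (x : M.State × (Fin 2 → ℕ)) (k : Fin 2) :
    (M.next x).2 k ≤ x.2 k + 1 ∧ x.2 k ≤ (M.next x).2 k + 1 := by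
  unfold next step
  cases hq : M.prog x.1 with
  | inc i p =>
    by_cases hk : k = i
    · subst hk; simp [CounterInstr.exec]; omega
    · simp [CounterInstr.exec, hk]
  | dec i p =>
    by_cases hk : k = i
    · subst hk; simp [CounterInstr.exec]; omega
    · simp [CounterInstr.exec, hk]
  | ifZero i p r => simp [CounterInstr.exec]
  | goto p => simp [CounterInstr.exec]
  | halt => simp [CounterInstr.exec]

/-- This converts a large change of a counter into a long run, hence into a repeated state. -/
theorem iterate_next_le (x : M.State × (Fin 2 → ℕ)) (k : Fin 2) (t : ℕ) :
    (M.next^[t] x).2 k ≤ x.2 k + t ∧ x.2 k ≤ (M.next^[t] x).2 k + t := by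
  induction t with
  | zero => simp
  | succ t ih =>
    rw [Function.iterate_succ_apply']
    have := next_le (M.next^[t] x) k
    omega

/-- While both counters are positive, a step depends on the state only. -/
theorem next_of_pos {x y : M.State × (Fin 2 → ℕ)} (hxy : x.1 = y.1)
    (hx : ∀ k, 0 < x.2 k) (hy : ∀ k, 0 < y.2 k) :
    (M.next x).1 = (M.next y).1 ∧
      ∀ k, (M.next x).2 k + y.2 k = (M.next y).2 k + x.2 k := by
  unfold next step
  rw [hxy]
  cases hq : M.prog y.1 with
  | inc i p =>
    refine ⟨rfl, fun k => ?_⟩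
    by_cases hk : k = i
    · subst hk; simp [CounterInstr.exec]; omega
    · simp [CounterInstr.exec, hk]; omega
  | dec i p =>
    refine ⟨rfl, fun k => ?_⟩
    have h1 := hx k
    have h2 := hy k
    by_cases hk : k = i
    · subst hk; simp [CounterInstr.exec]; omega
    · simp [CounterInstr.exec, hk]; omega
  | ifZero i p r =>
    have h1 := (hx i).ne'
    have h2 := (hy i).ne'
    simp [CounterInstr.exec, h1, h2, add_comm]
  | goto p => simp [CounterInstr.exec, add_comm]
  | halt => simp [CounterInstr.exec, add_comm, hxy]

/-- If a state repeats while both counters are positive, the run is periodic from then on, up to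
a constant change of the counters, for as long as the counters remain positive. -/
theorem iterate_next_periodic {x : M.State × (Fin 2 → ℕ)} {s p τ : ℕ}
    (hpos : ∀ t, s ≤ t → t < τ → ∀ k, 0 < (M.next^[t] x).2 k)
    (hp : 0 < p) (hrep : (M.next^[s + p] x).1 = (M.next^[s] x).1) (t : ℕ) (ht : s + t + p ≤ τ) :
    (M.next^[s + t + p] x).1 = (M.next^[s + t] x).1 ∧
      ∀ k, (M.next^[s + t + p] x).2 k + (M.next^[s] x).2 k =
        (M.next^[s + t] x).2 k + (M.next^[s + p] x).2 k := by
  induction t with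
  | zero => exact ⟨hrep, fun k => add_comm _ _⟩
  | succ t ih =>
    obtain ⟨h1, h2⟩ := ih (by omega)
    obtain ⟨h3, h4⟩ := next_of_pos h1 (hpos _ (by omega) (by omega)) (hpos _ (by omega) (by omega))
    rw [show s + (t + 1) + p = (s + t + p) + 1 by omega, show s + (t + 1) = (s + t) + 1 by omega,
      Function.iterate_succ_apply', Function.iterate_succ_apply']
    refine ⟨h3, fun k => ?_⟩
    have := h2 k
    have := h4 k
    omega

/-- Within the first `Nat.card M.State + 1` steps of a run some state repeats. -/
theorem exists_repeat (x : M.State × (Fin 2 → ℕ)) :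
    ∃ s p, 1 ≤ s ∧ 0 < p ∧ s + p ≤ Nat.card M.State + 1 ∧
      (M.next^[s + p] x).1 = (M.next^[s] x).1 := by
  have := M.finite_state
  have := Fintype.ofFinite M.State
  -- Times start at 1, because in the application one counter is empty at time 0.
  obtain ⟨a, b, hab, heq⟩ := Fintype.exists_ne_map_eq_of_card_lt
    (fun t : Fin (Nat.card M.State + 1) => (M.next^[t.1 + 1] x).1) (by simp)
  rcases lt_or_gt_of_ne (fun h => hab (Fin.ext h) : a.1 ≠ b.1) with h | h
  · refine ⟨a.1 + 1, b.1 - a.1, by omega, by omega, by omega, ?_⟩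
    rw [show a.1 + 1 + (b.1 - a.1) = b.1 + 1 by omega]
    exact heq.symm
  · refine ⟨b.1 + 1, a.1 - b.1, by omega, by omega, by omega, ?_⟩
    rw [show b.1 + 1 + (a.1 - b.1) = a.1 + 1 by omega]
    exact heq

/-- Running `m` times through a loop that trades `A` for `B`. -/
theorem iterate_loop {y : M.State × (Fin 2 → ℕ)} {p : ℕ} {A B : Fin 2 → ℕ}
    (hpos : ∀ t < p, ∀ k, 0 < (M.next^[t] y).2 k) (hrep : (M.next^[p] y).1 = y.1)
    (heq : (M.next^[p] y).2 + A = y.2 + B) (m n : ℕ) :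
    M.next^[p * m] (y.1, y.2 + (m • A + n • B)) = (y.1, y.2 + (n + m) • B) := by
  -- Here `n` counts the turns already made; their gain `n • B` is carried along unchanged.
  induction m generalizing n with
  | zero => simp
  | succ m ih =>
    rw [Nat.mul_succ, Function.iterate_add_apply,
      iterate_next_add y _ p fun t ht k h0 => absurd h0 (hpos t ht k).ne', hrep,
      show (M.next^[p] y).2 + ((m + 1) • A + n • B) = y.2 + (m • A + (n + 1) • B) by
        rw [succ_nsmul, succ_nsmul, show (M.next^[p] y).2 + (m • A + A + n • B) =
          ((M.next^[p] y).2 + A) + (m • A + n • B) by abel, heq]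
        abel, ih]
    congr 3
    omega

/-! ### Affine families of halting computations -/

/-- There are finitely many configurations with counters at most `T`, and each has at most one
output. -/
theorem bddAbove_outputs (M : TCM) (j : Fin 2) (T : ℕ) :
    ∃ K, ∀ (x : M.State × (Fin 2 → ℕ)) (o : ℕ), (∀ k, x.2 k ≤ T) → M.HaltsWith j x o → o ≤ K := by
  have := M.finite_state
  have hfin : (⋃ x ∈ (Set.univ : Set M.State) ×ˢ Set.Iic (fun _ : Fin 2 => T),
      {o | M.HaltsWith j x o}).Finite :=
    (Set.finite_univ.prod (Set.finite_Iic _)).biUnion fun x _ =>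
      Set.Subsingleton.finite fun _ h _ h' => h.unique h'
  obtain ⟨K, hK⟩ := hfin.bddAbove
  refine ⟨K, fun x o hx ho => hK ?_⟩
  simp only [Set.mem_iUnion]
  exact ⟨x, ⟨trivial, hx⟩, ho⟩

/-- A halting computation that starts with one empty counter and has a large output belongs to an
infinite linear family of such computations. -/
theorem exists_linear_family (j : Fin 2) {K : ℕ} (hKS : Nat.card M.State + 1 ≤ K)
    (hK : ∀ (x : M.State × (Fin 2 → ℕ)) (o : ℕ), (∀ k, x.2 k ≤ Nat.card M.State + 1) →
      M.HaltsWith j x o → o ≤ K) (L : ℕ) :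
    ∀ (i i' : Fin 2) (x : M.State × (Fin 2 → ℕ)), i ≠ i' → x.2 i' = 0 →
      M.prog (M.next^[L] x).1 = .halt → K < (M.next^[L] x).2 j →
      ∃ A Q, 0 < A ∧ 0 < Q ∧
        ∀ k, M.HaltsWith j (x.1, x.2 + Pi.single i (k * A)) ((M.next^[L] x).2 j + k * Q) := by
  induction L using Nat.strong_induction_on with
  | _ L IH =>
  intro i i' x hii hx hhalt hout
  have hcases : ∀ k, k = i ∨ k = i' := by omega
  have hbig : Nat.card M.State + 1 < x.2 i := by
    by_contra hle
    have := hK x _ (fun k => by rcases hcases k with rfl | rfl <;> omega) ⟨L, hhalt, rfl⟩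
    omega
  -- `τ` ends the first phase: the first time after 0 with an empty counter, or the end of the run.
  obtain ⟨τ, hτL, hpos, hend⟩ : ∃ τ, τ ≤ L ∧
      (∀ t, 1 ≤ t → t < τ → ∀ k, 0 < (M.next^[t] x).2 k) ∧
      (τ = L ∨ 1 ≤ τ ∧ ∃ k, (M.next^[τ] x).2 k = 0) := by
    classical
    have hex : ∃ t, t = L ∨ 1 ≤ t ∧ ∃ k, (M.next^[t] x).2 k = 0 := ⟨L, Or.inl rfl⟩
    refine ⟨Nat.find hex, Nat.find_min' hex (Or.inl rfl), fun t h1 ht k => ?_, Nat.find_spec hex⟩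
    have := Nat.find_min hex ht
    push Not at this
    exact Nat.pos_of_ne_zero (this.2 h1 k)
  have hshift : ∀ (t a : ℕ), t ≤ τ →
      M.next^[t] (x.1, x.2 + Pi.single i a) =
        ((M.next^[t] x).1, (M.next^[t] x).2 + Pi.single i a) := by
    intro t a ht
    refine iterate_next_add x _ t fun s hs k hk => ?_
    rcases hcases k with rfl | rfl
    · rcases Nat.eq_zero_or_pos s with rfl | h
      · simp at hk; omega
      · exact absurd hk (hpos s h (by omega) _).ne'
    · simp [hii.symm]
  have hsplit : M.next^[L] x = M.next^[L - τ] (M.next^[τ] x) := by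
    rw [← Function.iterate_add_apply, Nat.sub_add_cancel hτL]
  obtain ⟨s, p, hs, hp, hsp, hrep⟩ := exists_repeat x
  have hper := fun hτ : s + p ≤ τ => iterate_next_periodic (τ := τ)
    (fun t h1 h2 => hpos t (by omega) h2) hp hrep
  -- either the second counter stays small or every loop increases it
  have hgrow : Nat.card M.State + 1 < (M.next^[τ] x).2 i' →
      s + p < τ ∧ (M.next^[s] x).2 i' < (M.next^[s + p] x).2 i' := by
    intro hlarge
    have hτ : Nat.card M.State + 1 < τ := by
      have := (iterate_next_le x i' τ).1
      omega
    refine ⟨by omega, ?_⟩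
    by_contra hle
    -- A loop that does not raise `i'` keeps it below its values in the first `s + p` steps, and it
    -- started at 0.
    have key : ∀ t ≤ τ, (M.next^[t] x).2 i' ≤ Nat.card M.State + 1 := by
      intro t
      induction t using Nat.strong_induction_on with
      | _ t ih =>
      intro ht
      rcases le_or_gt t (s + p) with h | h
      · have := (iterate_next_le x i' t).1
        omega
      · have h1 := (hper (by omega) (t - s - p) (by omega)).2 i'
        rw [show s + (t - s - p) + p = t by omega, show s + (t - s - p) = t - p by omega] at h1
        have := ih (t - p) (by omega) (by omega)
        omega
    have := key τ le_rfl
    omega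
  by_cases hi' : 1 ≤ τ ∧ (M.next^[τ] x).2 i' = 0
  -- The surplus in `i` passes through the phase unchanged.
  · obtain ⟨A, Q, hA, hQ, h⟩ := IH (L - τ) (by omega) i i' _ hii hi'.2
      (by rwa [← hsplit]) (by rwa [← hsplit])
    refine ⟨A, Q, hA, hQ, fun k => HaltsWith.of_iterate τ ?_⟩
    rw [hshift τ _ le_rfl, hsplit]
    exact h k
  by_cases hi : 1 ≤ τ ∧ (M.next^[τ] x).2 i = 0
  · obtain ⟨A, Q, hA, hQ, h⟩ := IH (L - τ) (by omega) i' i _ hii.symm hi.2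
      (by rwa [← hsplit]) (by rwa [← hsplit])
    have hlarge : Nat.card M.State + 1 < (M.next^[τ] x).2 i' := by
      by_contra hle
      have := hK (M.next^[τ] x) _ (fun k => by rcases hcases k with rfl | rfl <;> omega)
        ⟨L - τ, by rwa [← hsplit], rfl⟩
      rw [← hsplit] at this
      omega
    obtain ⟨hτ, hβ⟩ := hgrow hlarge
    -- A loop that does not lower `i` could not bring it from above `Nat.card M.State + 1` down to
    -- 0.
    have hα : (M.next^[s + p] x).2 i < (M.next^[s] x).2 i := by
      by_contra hle
      have key : ∀ t ≤ τ, x.2 i ≤ (M.next^[t] x).2 i + (Nat.card M.State + 1) := by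
        intro t
        induction t using Nat.strong_induction_on with
        | _ t ih =>
        intro ht
        rcases le_or_gt t (s + p) with h | h
        · have := (iterate_next_le x i t).2
          omega
        · have h1 := (hper (by omega) (t - s - p) (by omega)).2 i
          rw [show s + (t - s - p) + p = t by omega, show s + (t - s - p) = t - p by omega] at h1
          have := ih (t - p) (by omega) (by omega)
          omega
      have := key τ le_rfl
      omega
    obtain ⟨a, ha⟩ := Nat.exists_eq_add_of_lt hα
    obtain ⟨β, hβ'⟩ := Nat.exists_eq_add_of_lt hβ
    have hsτ : M.next^[τ] x = M.next^[τ - s] (M.next^[s] x) := by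
      rw [← Function.iterate_add_apply, Nat.sub_add_cancel (by omega)]
    -- Run to the loop, make `m` additional turns, then follow the original phase to its end.
    have hpump : ∀ m, M.next^[(τ - s) + (p * m + s)] (x.1, x.2 + Pi.single i (m * (a + 1))) =
        ((M.next^[τ] x).1, (M.next^[τ] x).2 + Pi.single i' (m * (β + 1))) := by
      intro m
      rw [Function.iterate_add_apply, Function.iterate_add_apply, hshift s _ (by omega)]
      have hloop := iterate_loop (M := M) (y := M.next^[s] x) (p := p)
        (A := Pi.single i (a + 1)) (B := Pi.single i' (β + 1))
        (fun t ht k => by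
          rw [← Function.iterate_add_apply]
          exact hpos _ (by omega) (by omega) k)
        (by rw [← Function.iterate_add_apply, add_comm p, hrep])
        (by
          rw [← Function.iterate_add_apply, add_comm p]
          ext k
          rcases hcases k with rfl | rfl
          · simp [hii]; omega
          · simp [hii.symm]; omega) m 0
      simp only [zero_smul, add_zero, zero_add, ← Pi.single_smul, smul_eq_mul] at hloop
      rw [hloop, hsτ]
      refine iterate_next_add _ _ _ fun t ht k hk => ?_
      rw [← Function.iterate_add_apply] at hk
      exact absurd hk (hpos _ (by omega) (by omega) k).ne'
    -- The gain in `i'` is a multiple of `β + 1` and must be a multiple of `A`, so `k * A` extra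
    -- turns are made, reaching member `k * (β + 1)` of the later family.
    refine ⟨A * (a + 1), (β + 1) * Q, by positivity, by positivity, fun k => ?_⟩
    have h1 := h (k * (β + 1))
    rw [← hsplit, show k * (β + 1) * A = (k * A) * (β + 1) by ring, ← hpump (k * A)] at h1
    have h2 := h1.of_iterate
    rwa [mul_assoc, mul_assoc] at h2
  have hτeq : τ = L := by
    rcases hend with h | ⟨h1, k, hk⟩
    · exact h
    · rcases hcases k with rfl | rfl
      · exact absurd ⟨h1, hk⟩ hi
      · exact absurd ⟨h1, hk⟩ hi'
  subst hτeq
  rcases hcases j with rfl | rfl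
  · refine ⟨1, 1, one_pos, one_pos, fun k => ⟨τ, ?_, ?_⟩⟩
    · rwa [hshift τ _ le_rfl]
    · rw [hshift τ _ le_rfl]
      simp
  -- A large output in `i'` needs a loop that raises it, but the state one period before the end is
  -- already halting, so nothing changes any more.
  · exfalso
    obtain ⟨hτ, hβ⟩ := hgrow (by omega)
    obtain ⟨h1, h2⟩ := hper hτ.le (τ - s - p) (by omega)
    rw [show s + (τ - s - p) + p = τ by omega, show s + (τ - s - p) = τ - p by omega] at h1 h2
    have h3 : M.next^[τ] x = M.next^[τ - p] x := by
      rw [show M.next^[τ] x = M.next^[p] (M.next^[τ - p] x) by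
        rw [← Function.iterate_add_apply, Nat.add_sub_cancel' (by omega)]]
      exact iterate_next_of_halt (by rwa [← h1]) p
    have h4 := h2 j
    rw [h3] at h4
    omega

/-- A function with unbounded range that is computed by a two counter machine is linear and not
constant on some arithmetic progression. -/
theorem Computes.exists_linear {f : ℕ → ℕ} (h : M.Computes f) (hf : ¬ BddAbove (Set.range f)) :
    ∃ n A Q, 0 < A ∧ 0 < Q ∧ ∀ k, f (n + k * A) = f n + k * Q := by
  obtain ⟨i, j, h⟩ := h
  have hhalts : ∀ n, M.HaltsWith j (M.start, Pi.single i n) (f n) := by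
    intro n
    obtain ⟨q, c, hrun, hq, hc⟩ := h n
    obtain ⟨t, ht⟩ := exists_iterate_of_reflTransGen hrun
    exact ⟨t, by rw [ht]; exact hq, by rw [ht]; exact hc⟩
  obtain ⟨K, hK⟩ := bddAbove_outputs M j (Nat.card M.State + 1)
  obtain ⟨_, ⟨n, rfl⟩, hn⟩ := not_bddAbove_iff.1 hf (max K (Nat.card M.State + 1))
  obtain ⟨L, hL, hLo⟩ := hhalts n
  have hi : i ≠ 1 - i := by omega
  obtain ⟨A, Q, hA, hQ, hlin⟩ := exists_linear_family j (le_max_right K _)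
    (fun x o hx ho => (hK x o hx ho).trans (le_max_left _ _)) L i (1 - i)
    (M.start, Pi.single i n) hi
    (by simp [hi.symm]) hL (by omega)
  refine ⟨n, A, Q, hA, hQ, fun k => ?_⟩
  have h1 := hlin k
  rw [← Pi.single_add, hLo] at h1
  exact (hhalts _).unique h1

end TCM

/-! ### State renaming and digits of affine images -/

/-- Renaming the states of an instruction. -/
def CounterInstr.map {Q R : Type} (g : Q → R) : CounterInstr Q → CounterInstr R
  | .inc i q => .inc i (g q)
  | .dec i q => .dec i (g q)
  | .ifZero i yes no => .ifZero i (g yes) (g no)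
  | .goto q => .goto (g q)
  | .halt => .halt

theorem CounterInstr.exec_map {Q R : Type} (g : Q → R) (c : Fin 2 → ℕ) (I : CounterInstr Q) :
    (I.map g).exec c = (I.exec c).map fun y => (g y.1, y.2) := by
  cases I <;> simp [CounterInstr.map, CounterInstr.exec]
  split <;> rfl

/-- The digits of a number in radix `b`, the least significant digit first. -/
def carryDigits (b : ℕ) [NeZero b] (c : ℕ) : List (Fin b) :=
  (Nat.digits b c).map (Fin.ofNat b)

/-- The digits of `A * n + c`, computed from the digits of `n` with carry `c`. -/
def affineDigits (b : ℕ) [NeZero b] (A : ℕ) : List (Fin b) → ℕ → List (Fin b)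
  | [], c => carryDigits b c
  | d :: I, c => Fin.ofNat b (A * d + c) :: affineDigits b A I ((A * d + c) / b)

theorem digitValue_carryDigits {b : ℕ} [NeZero b] (hb : 2 ≤ b) (c : ℕ) :
    digitValue (carryDigits b c) = c := by
  rw [digitValue, carryDigits, List.map_map]
  conv_rhs => rw [← Nat.ofDigits_digits b c]
  congr 1
  conv_rhs => rw [← List.map_id (Nat.digits b c)]
  refine List.map_congr_left fun d hd => ?_
  simp [Nat.mod_eq_of_lt (Nat.digits_lt_base (by omega) hd)]

theorem digitValue_affineDigits {b : ℕ} [NeZero b] (hb : 2 ≤ b) (A : ℕ) (I : List (Fin b))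
    (c : ℕ) : digitValue (affineDigits b A I c) = A * digitValue I + c := by
  induction I generalizing c with
  | nil => exact (digitValue_carryDigits hb c).trans (by simp [digitValue])
  | cons d I ih =>
    have h := ih ((A * d + c) / b)
    have hm := Nat.mod_add_div (A * d + c) b
    simp only [digitValue, affineDigits, List.map_cons, Nat.ofDigits_cons, Fin.val_ofNat] at h ⊢
    rw [h]
    linear_combination hm

theorem carryDigits_zero (b : ℕ) [NeZero b] : carryDigits b 0 = [] := by
  simp [carryDigits]

theorem carryDigits_of_ne_zero {b : ℕ} [NeZero b] (hb : 2 ≤ b) {c : ℕ} (hc : c ≠ 0) :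
    carryDigits b c = Fin.ofNat b c :: carryDigits b (c / b) := by
  rw [carryDigits, Nat.digits_def' (by omega) (by omega), List.map_cons, carryDigits]
  congr 1
  ext
  simp

/-- The bound `C` on carries is preserved by every digit, so a carry fits into the finite control.
-/
theorem carry_le {b A c C d : ℕ} (hA : A ≤ C) (hc : c ≤ C) (hd : d < b) :
    (A * d + c) / b ≤ C := by
  refine Nat.div_le_of_le_mul ?_
  calc A * d + c ≤ C * d + C := by gcongr
    _ = (d + 1) * C := by ring
    _ ≤ b * C := by gcongr; omega

/-! ### The simulating machine -/

/-- The states of the machine that simulates a machine with states `S` on an affine image of its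
input and then inverts an affine function: `run` while digits are read, `flush` while the carry
is emitted, `finish` after the stop marker, and the others for the arithmetic on the result. -/
inductive SimState (S : Type) (C R : ℕ) : Type where
  | run (s : S) (c : Fin (C + 1))
  | flush (s : S) (c : Fin (C + 1))
  | finish (s : S)
  | drop (count : Bool) (k : Fin (R + 1))
  | test
  | move
  | moveDec
  | moveInc
  | halted

namespace SimState

/-- An injection into a type that is visibly finite if `S` is. -/
def code {S : Type} {C R : ℕ} :
    SimState S C R → (Bool × S × Fin (C + 1)) ⊕ S ⊕ (Bool × Fin (R + 1)) ⊕ Fin 5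
  | run s c => .inl (true, s, c)
  | flush s c => .inl (false, s, c)
  | finish s => .inr (.inl s)
  | drop e k => .inr (.inr (.inl (e, k)))
  | test => .inr (.inr (.inr 0))
  | move => .inr (.inr (.inr 1))
  | moveDec => .inr (.inr (.inr 2))
  | moveInc => .inr (.inr (.inr 3))
  | halted => .inr (.inr (.inr 4))

theorem code_injective {S : Type} {C R : ℕ} : Function.Injective (@code S C R) := by
  intro x y h
  cases x <;> cases y <;> simp_all [code]

instance {S : Type} [Finite S] {C R : ℕ} : Finite (SimState S C R) :=
  Finite.of_injective _ code_injective

end SimState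

namespace TCMI

open SimState

/-- The machine that on input `n` simulates `M` on input `A * n + n₀`, subtracts `r` from the
result and divides it by `q`. Carries are at most `C`, and `r` and `q` at most `R`. -/
def affineSim {b : ℕ} [NeZero b] (M : TCMI b) (A n₀ r q C R : ℕ) : TCMI b where
  State := SimState M.State C R
  finite_state := by
    have := M.finite_state
    infer_instance
  start := run M.start (Fin.ofNat _ n₀)
  prog
    | run s c =>
      match M.prog s with
      | .op I => .op (I.map fun s' => run s' c)
      | .read next => .read fun
        | .digit d => run (next (.digit (Fin.ofNat b (A * d + c)))) (Fin.ofNat _ ((A * d + c) / b))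
        | .endMark => flush s c
    | flush s c =>
      match M.prog s with
      | .op I => .op (I.map fun s' => flush s' c)
      | .read next => .op <| .goto <|
          if c.val = 0 then finish (next .endMark)
          else flush (next (.digit (Fin.ofNat b c))) (Fin.ofNat _ (c / b))
    | finish s =>
      match M.prog s with
      | .op .halt => .op (.goto (drop false (Fin.ofNat _ r)))
      | .op I => .op (I.map finish)
      | .read _ => .op (.goto (drop false (Fin.ofNat _ r)))
    | drop e k =>
      if k.val = 0 then .op (if e then .inc 1 test else .goto test)
      else .op (.dec 0 (drop e (Fin.ofNat _ (k - 1))))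
    | test => .op (.ifZero 0 move (drop true (Fin.ofNat _ q)))
    | move => .op (.ifZero 1 halted moveDec)
    | moveDec => .op (.dec 1 moveInc)
    | moveInc => .op (.inc 0 move)
    | halted => .op .halt

/-- `y` is reachable from `x`. -/
abbrev Steps {b : ℕ} (M : TCMI b) : M.Cfg → M.Cfg → Prop :=
  Relation.ReflTransGen fun x y => M.step x = some y

theorem update_zero (m n k : ℕ) : Function.update ![m, n] 0 k = ![k, n] := by
  ext i
  fin_cases i <;> rfl

theorem update_one (m n k : ℕ) : Function.update ![m, n] 1 k = ![m, k] := by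
  ext i
  fin_cases i <;> rfl

section

variable {b : ℕ}

theorem steps_of_op {N : TCMI b} {s s' : N.State} {c c' : Fin 2 → ℕ} {z : List (InputSymbol b)}
    {I : CounterInstr N.State} (h : N.prog s = .op I) (hI : I.exec c = some (s', c')) :
    N.Steps ⟨s, c, z⟩ ⟨s', c', z⟩ :=
  .single (by simp [step, h, hI])

theorem steps_of_read {N : TCMI b} {s : N.State} {c : Fin 2 → ℕ} {z : List (InputSymbol b)}
    {a : InputSymbol b} {next : InputSymbol b → N.State} (h : N.prog s = .read next) :
    N.Steps ⟨s, c, a :: z⟩ ⟨next a, c, z⟩ :=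
  .single (by simp [step, h])

theorem withStop_cons (d : Fin b) (I : List (Fin b)) :
    withStop (d :: I) = .digit d :: withStop I := rfl

theorem withStop_nil : withStop ([] : List (Fin b)) = [.endMark] := rfl

theorem withStop_ne_nil (I : List (Fin b)) : withStop I ≠ [] := by
  simp [withStop]

theorem step_of_op {N : TCMI b} {x y : N.Cfg} {I : CounterInstr N.State}
    (h : N.prog x.state = .op I) (hxy : N.step x = some y) :
    I.exec x.counters = some (y.state, y.counters) ∧ y.input = x.input := by
  simp only [step, h, Option.map_eq_some_iff] at hxy
  obtain ⟨z, hz, rfl⟩ := hxy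
  exact ⟨hz, rfl⟩

theorem step_of_read {N : TCMI b} {x y : N.Cfg} {next : InputSymbol b → N.State}
    {a : InputSymbol b} {z : List (InputSymbol b)}
    (h : N.prog x.state = .read next) (hx : x.input = a :: z) (hxy : N.step x = some y) :
    y = ⟨next a, x.counters, z⟩ := by
  simp only [step, h, hx, Option.some.injEq] at hxy
  exact hxy.symm

end

/-! ### Correctness of the simulation and of the final arithmetic -/

section

variable {b : ℕ} [NeZero b] {M : TCMI b} {A n₀ r q C R : ℕ}

/-- A configuration of `M` and the configuration of `affineSim` that represents it. -/
inductive Sim (M : TCMI b) (A n₀ r q C R : ℕ) : M.Cfg → (M.affineSim A n₀ r q C R).Cfg → Prop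
  | run (s : M.State) (c : Fin (C + 1)) (n : Fin 2 → ℕ) (I : List (Fin b)) :
      Sim M A n₀ r q C R ⟨s, n, withStop (affineDigits b A I c)⟩ ⟨.run s c, n, withStop I⟩
  | flush (s : M.State) (c : Fin (C + 1)) (n : Fin 2 → ℕ) :
      Sim M A n₀ r q C R ⟨s, n, withStop (carryDigits b c)⟩ ⟨.flush s c, n, []⟩
  | finish (s : M.State) (n : Fin 2 → ℕ) :
      Sim M A n₀ r q C R ⟨s, n, []⟩ ⟨.finish s, n, []⟩

/-- It also serves `run` at the stop marker: reading the marker only switches to `flush`, and the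
pending read of `M` is then served from the carry. -/
theorem Sim.step_flush (hb : 2 ≤ b) {s : M.State} {c : Fin (C + 1)} {n : Fin 2 → ℕ} {y : M.Cfg}
    (hxy : M.step ⟨s, n, withStop (carryDigits b c)⟩ = some y) :
    ∃ y', (M.affineSim A n₀ r q C R).Steps ⟨.flush s c, n, []⟩ y' ∧ Sim M A n₀ r q C R y y' := by
  cases hs : M.prog s with
  | op I =>
    obtain ⟨t, m, z⟩ := y
    obtain ⟨h1, h2⟩ := step_of_op (x := ⟨s, n, _⟩) hs hxy
    simp only at h1 h2
    subst h2
    refine ⟨_, steps_of_op (s' := SimState.flush t c) (c' := m) (I := I.map fun s' => .flush s' c)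
      (by simp [affineSim, hs]) ?_, .flush t c m⟩
    exact (CounterInstr.exec_map _ _ _).trans (by rw [h1]; rfl)
  | read next =>
    have hprog : (M.affineSim A n₀ r q C R).prog (.flush s c) = .op (.goto
        (if c.val = 0 then .finish (next .endMark)
          else .flush (next (.digit (Fin.ofNat b c))) (Fin.ofNat _ (c / b)))) := by
      simp [affineSim, hs]
    have hgo := fun z => steps_of_op (c := n) (z := z) hprog rfl
    by_cases hc : c.val = 0
    · rw [hc, carryDigits_zero, withStop_nil] at hxy
      rw [step_of_read (x := ⟨s, n, _⟩) hs rfl hxy]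
      exact ⟨_, hgo [], by simp only [hc]; exact .finish _ _⟩
    · rw [carryDigits_of_ne_zero hb hc, withStop_cons] at hxy
      rw [step_of_read (x := ⟨s, n, _⟩) hs rfl hxy]
      refine ⟨_, hgo [], ?_⟩
      simp only [hc]
      have hlt : c.val / b < C + 1 := (Nat.div_le_self _ _).trans_lt c.2
      have := Sim.flush (M := M) (A := A) (n₀ := n₀) (r := r) (q := q) (R := R)
        (next (.digit (Fin.ofNat b c))) (Fin.ofNat (C + 1) (c / b)) n
      rwa [Fin.val_ofNat, Nat.mod_eq_of_lt hlt] at this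

theorem Sim.step (hb : 2 ≤ b) (hA : A ≤ C) {x y : M.Cfg}
    {x' : (M.affineSim A n₀ r q C R).Cfg} (h : Sim M A n₀ r q C R x x')
    (hxy : M.step x = some y) :
    ∃ y', (M.affineSim A n₀ r q C R).Steps x' y' ∧ Sim M A n₀ r q C R y y' := by
  cases h with
  | flush s c n => exact Sim.step_flush hb hxy
  | finish s n =>
    cases hs : M.prog s with
    | op I =>
      obtain ⟨t, m, z⟩ := y
      obtain ⟨h1, h2⟩ := step_of_op (x := ⟨s, n, _⟩) hs hxy
      simp only at h1 h2
      subst h2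
      refine ⟨_, steps_of_op (s' := SimState.finish t) (c' := m) (I := I.map .finish) ?_ ?_,
        .finish t m⟩
      · cases I <;> simp_all [affineSim, CounterInstr.exec]
      · exact (CounterInstr.exec_map _ _ _).trans (by rw [h1]; rfl)
    | read next => simp [TCMI.step, hs] at hxy
  | run s c n I =>
    cases hs : M.prog s with
    | op J =>
      obtain ⟨t, m, z⟩ := y
      obtain ⟨h1, h2⟩ := step_of_op (x := ⟨s, n, _⟩) hs hxy
      simp only at h1 h2
      subst h2
      refine ⟨_, steps_of_op (s' := SimState.run t c) (c' := m) (I := J.map fun s' => .run s' c)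
        (by simp [affineSim, hs]) ?_, .run t c m I⟩
      exact (CounterInstr.exec_map _ _ _).trans (by rw [h1]; rfl)
    | read next =>
      have hprog : (M.affineSim A n₀ r q C R).prog (.run s c) = .read fun
          | .digit d => .run (next (.digit (Fin.ofNat b (A * d + c))))
              (Fin.ofNat _ ((A * d + c) / b))
          | .endMark => .flush s c := by
        simp [affineSim, hs]
      cases I with
      | nil =>
        obtain ⟨y', h1, h2⟩ := Sim.step_flush (A := A) (n₀ := n₀) (r := r) (q := q) (R := R) hb hxy
        exact ⟨y', (steps_of_read hprog).trans h1, h2⟩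
      | cons d I =>
        rw [affineDigits, withStop_cons] at hxy
        rw [step_of_read (x := ⟨s, n, _⟩) hs rfl hxy, withStop_cons]
        refine ⟨_, steps_of_read hprog, ?_⟩
        have hlt : (A * d.val + c.val) / b < C + 1 :=
          Nat.lt_succ_of_le (carry_le hA (Nat.le_of_lt_succ c.2) d.2)
        have := Sim.run (M := M) (A := A) (n₀ := n₀) (r := r) (q := q) (R := R)
          (next (.digit (Fin.ofNat b (A * d + c)))) (Fin.ofNat (C + 1) ((A * d + c) / b)) n I
        rwa [Fin.val_ofNat, Nat.mod_eq_of_lt hlt] at this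

theorem Sim.steps (hb : 2 ≤ b) (hA : A ≤ C) {x y : M.Cfg}
    {x' : (M.affineSim A n₀ r q C R).Cfg} (h : Sim M A n₀ r q C R x x') (hxy : M.Steps x y) :
    ∃ y', (M.affineSim A n₀ r q C R).Steps x' y' ∧ Sim M A n₀ r q C R y y' := by
  induction hxy with
  | refl => exact ⟨x', .refl, h⟩
  | tail _ hyz ih =>
    obtain ⟨y', h1, h2⟩ := ih
    obtain ⟨z', h3, h4⟩ := h2.step hb hA hyz
    exact ⟨z', h1.trans h3, h4⟩

theorem affineSim_simulates (hb : 2 ≤ b) (hA : A ≤ C) (hn₀ : n₀ ≤ C) {I : List (Fin b)}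
    {w : M.State} {m n : ℕ} (h : M.Reaches (withStop (affineDigits b A I n₀)) w m n) :
    (M.affineSim A n₀ r q C R).Steps ⟨.run M.start (Fin.ofNat _ n₀), ![0, 0], withStop I⟩
      ⟨.finish w, ![m, n], []⟩ := by
  have h0 := Sim.run (M := M) (A := A) (n₀ := n₀) (r := r) (q := q) (R := R)
    M.start (Fin.ofNat (C + 1) n₀) ![0, 0] I
  rw [Fin.val_ofNat, Nat.mod_eq_of_lt (Nat.lt_succ_of_le hn₀)] at h0
  obtain ⟨y', h1, h2⟩ := h0.steps hb hA h
  -- `M` has consumed its whole input, and among the represented configurations only `finish` has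
  -- none left.
  generalize hy : (⟨w, ![m, n], []⟩ : M.Cfg) = y at h2
  cases h2 with
  | run s c n I => exact absurd (congrArg Cfg.input hy).symm (withStop_ne_nil _)
  | flush s c n => exact absurd (congrArg Cfg.input hy).symm (withStop_ne_nil _)
  | finish s n =>
    cases hy
    exact h1

theorem affineSim_drop (e : Bool) (k m n : ℕ) (hk : k ≤ R) :
    (M.affineSim A n₀ r q C R).Steps ⟨.drop e (Fin.ofNat _ k), ![k + m, n], []⟩
      ⟨.test, ![m, if e then n + 1 else n], []⟩ := by
  induction k with
  | zero =>
    cases e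
    · refine steps_of_op (I := .goto .test) (by simp [affineSim]) ?_
      simp [CounterInstr.exec]
    · refine steps_of_op (I := .inc 1 .test) (by simp [affineSim]) ?_
      exact congrArg (fun c => some (_, c)) ((update_one _ _ _).trans (by simp))
  | succ k ih =>
    have hmod : (k + 1) % (R + 1) = k + 1 := Nat.mod_eq_of_lt (by omega)
    have h : (M.affineSim A n₀ r q C R).Steps ⟨.drop e (Fin.ofNat _ (k + 1)), ![k + 1 + m, n], []⟩
        ⟨.drop e (Fin.ofNat _ k), ![k + m, n], []⟩ := by
      refine steps_of_op (I := .dec 0 (.drop e (Fin.ofNat _ k))) ?_ ?_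
      · simp [affineSim, hmod]
      · exact congrArg (fun c => some (_, c))
          ((update_zero _ _ _).trans (by simp [Nat.add_right_comm k 1 m]))
    exact h.trans (ih (by omega))

/-- The counter holds an exact multiple of `q`, so the zero test between blocks of `q` decrements
never misses the end. -/
theorem affineSim_divide (hq : 0 < q) (hqR : q ≤ R) (k n : ℕ) :
    (M.affineSim A n₀ r q C R).Steps ⟨.test, ![k * q, n], []⟩ ⟨.move, ![0, n + k], []⟩ := by
  induction k generalizing n with
  | zero =>
    refine steps_of_op (I := .ifZero 0 .move (.drop true (Fin.ofNat _ q))) rfl ?_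
    simp [CounterInstr.exec]
  | succ k ih =>
    have h1 : (M.affineSim A n₀ r q C R).Steps ⟨.test, ![(k + 1) * q, n], []⟩
        ⟨.drop true (Fin.ofNat _ q), ![(k + 1) * q, n], []⟩ := by
      refine steps_of_op (I := .ifZero 0 .move (.drop true (Fin.ofNat _ q))) rfl ?_
      simp [CounterInstr.exec, hq.ne']
    have h2 := affineSim_drop (M := M) (A := A) (n₀ := n₀) (r := r) (q := q) (C := C)
      true q (k * q) n hqR
    rw [show q + k * q = (k + 1) * q by ring] at h2
    have h3 := ih (n + 1)
    rw [show n + 1 + k = n + (k + 1) by omega] at h3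
    exact h1.trans (h2.trans h3)

theorem affineSim_move (m n : ℕ) :
    (M.affineSim A n₀ r q C R).Steps ⟨.move, ![m, n], []⟩ ⟨.halted, ![m + n, 0], []⟩ := by
  induction n generalizing m with
  | zero =>
    refine steps_of_op (I := .ifZero 1 .halted .moveDec) rfl ?_
    simp [CounterInstr.exec]
  | succ n ih =>
    have h1 : (M.affineSim A n₀ r q C R).Steps ⟨.move, ![m, n + 1], []⟩
        ⟨.moveDec, ![m, n + 1], []⟩ :=
      steps_of_op (I := .ifZero 1 .halted .moveDec) rfl (by simp [CounterInstr.exec])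
    have h2 : (M.affineSim A n₀ r q C R).Steps ⟨.moveDec, ![m, n + 1], []⟩
        ⟨.moveInc, ![m, n], []⟩ :=
      steps_of_op (I := .dec 1 .moveInc) rfl
        (congrArg (fun c => some (_, c)) (update_one _ _ _))
    have h3 : (M.affineSim A n₀ r q C R).Steps ⟨.moveInc, ![m, n], []⟩
        ⟨.move, ![m + 1, n], []⟩ :=
      steps_of_op (I := .inc 0 .move) rfl
        (congrArg (fun c => some (_, c)) (update_zero _ _ _))
    have h4 := ih (m + 1)
    rw [show m + 1 + n = m + (n + 1) by omega] at h4
    exact h1.trans (h2.trans (h3.trans h4))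

theorem affineSim_finish {w : M.State} (hw : M.IsWait w ∨ M.IsHalt w) (c : Fin 2 → ℕ) :
    (M.affineSim A n₀ r q C R).Steps ⟨.finish w, c, []⟩ ⟨.drop false (Fin.ofNat _ r), c, []⟩ := by
  refine steps_of_op (I := .goto (.drop false (Fin.ofNat _ r))) ?_ rfl
  rcases hw with ⟨next, h⟩ | h
  · simp [affineSim, h]
  · rw [IsHalt] at h
    simp [affineSim, h]

end

end TCMI

theorem mainTheorem5 (f : ℕ → ℕ) (hf : ¬ BddAbove (Set.range f))
    (Mf : TCM) (hMf : Mf.Computes f) (b : ℕ) (hb : 2 ≤ b)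
    (M : TCMI b)
    (hM : ∀ I : List (Fin b), ∃ w : M.State, (M.IsWait w ∨ M.IsHalt w) ∧
      M.Reaches (withStop I) w (f (digitValue I)) 0) :
    ∃ M' : TCMI b, M'.Counts := by
  have : NeZero b := ⟨by omega⟩
  obtain ⟨n₀, A, q, -, hq, hlin⟩ := hMf.exists_linear hf
  refine ⟨M.affineSim A n₀ (f n₀) q (max A n₀) (max (f n₀) q), fun I => ⟨.halted, rfl, ?_⟩⟩
  obtain ⟨w, hw, hrun⟩ := hM (affineDigits b A I n₀)
  -- On the transformed digits `M` ends with `f n₀ + digitValue I * q`, which the final arithmetic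
  -- inverts.
  rw [digitValue_affineDigits hb, add_comm, mul_comm, hlin] at hrun
  have h1 := TCMI.affineSim_simulates (r := f n₀) (q := q) (R := max (f n₀) q) hb
    (le_max_left A n₀) (le_max_right A n₀) hrun
  have h2 := h1.trans (TCMI.affineSim_finish hw _)
  have h3 := h2.trans (TCMI.affineSim_drop false (f n₀) (digitValue I * q) 0 (le_max_left _ _))
  have h4 := h3.trans (TCMI.affineSim_divide hq (le_max_right _ _) (digitValue I) 0)
  have h5 := h4.trans (TCMI.affineSim_move 0 (0 + digitValue I))
  rwa [zero_add, zero_add] at h5
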